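/- Let $F$ be an algebraically closed field with $\operatorname{char} F\neq 2$, let $G$ be an arbitrary group (not necessarily abelian), and let $m,n\ge 1$ be integers. For $k\ge 1$ let $UT_k(F)$ be the algebra of $k\times k$ upper triangular matrices over $F$. A $G$-grading on an $F$-algebra $A$ is a vector space decomposition $A=\bigoplus_{g\in G}A_g$ with $A_gA_h\subseteq A_{gh}$ for all $g,h\in G$. A graded involution on $A$ is an $F$-linear map $\circ:A\to A$ with $(a^{\circ})^{\circ}=a$ and $(ab)^{\circ}=b^{\circ}a^{\circ}$ for all $a,b\in A$, and $A_g^{\circ}\subseteq A_g$ for all $g\in G$. Two $G$-graded algebras with graded involutions $(A,\circ)$ and $(B,\diamond)$ are isomorphic as $(G,*)$-algebras if there is an isomorphism of algebras $\varphi:A\to B$ with $\varphi(A_g)\subseteq B_g$ for all $g\in G$ and $\varphi(a^{\circ})=\varphi(a)^{\diamond}$ for all $a\in A$. Let $F_{G,*}\langle X\rangle$ be the free associative $F$-algebra on the pairwise distinct indeterminates $x_{i,g},\ x_{i,g}^{*}$ ($i\in\mathbb{N}$, $g\in G$). A polynomial $f\in F_{G,*}\langle X\rangle$ is a $(G,*)$-identity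 of $(A,\circ)$ if, for every choice of elements $a_{i,g}\in A_g$ ($i\in\mathbb{N}$, $g\in G$), $f$ becomes $0$ after substituting $x_{i,g}\mapsto a_{i,g}$ and $x_{i,g}^{*}\mapsto a_{i,g}^{\circ}$. Let $T_{G,*}(A,\circ)$ be the set of all $(G,*)$-identities of $(A,\circ)$. Let $\mathcal{U}$ be $UT_m(F)$ equipped with a $G$-grading and let $\mathcal{U}'$ be $UT_n(F)$ equipped with a $G$-grading. Let $\circ$ be a graded involution on $\mathcal{U}$ and $\diamond$ a graded involution on $\mathcal{U}'$. Then $(\mathcal{U},\circ)$ and $(\mathcal{U}',\diamond)$ are isomorphic as $(G,*)$-algebras if and only if $T_{G,*}(\mathcal{U},\circ)=T_{G,*}(\mathcal{U}',\diamond)$. -/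

import Mathlib

/-- The algebra `UT_m(F)` of `m × m` upper triangular matrices over `F`: all matrices whose
entries strictly below the diagonal are zero. -/
abbrev UT (m : ℕ) (F : Type*) [Field F] : Subalgebra F (Matrix (Fin m) (Fin m) F) :=
  Matrix.blockTriangularSubalgebra F F (id : Fin m → Fin m)

/-- A grading by the group `G` on the `F`-algebra `A`: a vector space decomposition
`A = ⨁ g, A_g` with `A_g A_h ⊆ A_{gh}`. -/
structure GroupGrading (F A G : Type*) [Field F] [Ring A] [Algebra F A] [Group G] where
  /-- The homogeneous component of degree `g`. -/
  comp : G → Submodule F A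
  /-- The sum of the homogeneous components is direct ... -/
  indep : iSupIndep comp
  /-- ... and is the whole algebra. -/
  iSup_eq_top : ⨆ g, comp g = ⊤
  mul_mem : ∀ {g h : G} {a b : A}, a ∈ comp g → b ∈ comp h → a * b ∈ comp (g * h)

/-- A graded involution on a `G`-graded algebra: an `F`-linear anti-automorphism of order at
most two that preserves every homogeneous component. -/
structure GradedInvolution {F A G : Type*} [Field F] [Ring A] [Algebra F A] [Group G]
    (𝒰 : GroupGrading F A G) where
  /-- The underlying linear map. -/
  inv : A →ₗ[F] A
  inv_inv : ∀ a : A, inv (inv a) = a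
  inv_mul : ∀ a b : A, inv (a * b) = inv b * inv a
  inv_mem : ∀ {g : G} {a : A}, a ∈ 𝒰.comp g → inv a ∈ 𝒰.comp g

/-- Two `G`-graded algebras with graded involution are isomorphic as `(G, *)`-algebras. -/
def GStarIsomorphic {F A B G : Type*} [Field F] [Ring A] [Algebra F A] [Ring B] [Algebra F B]
    [Group G] {𝒰 : GroupGrading F A G} {𝒱 : GroupGrading F B G}
    (s : GradedInvolution 𝒰) (t : GradedInvolution 𝒱) : Prop :=
  ∃ φ : A ≃ₐ[F] B, (∀ g : G, ∀ a ∈ 𝒰.comp g, φ a ∈ 𝒱.comp g) ∧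
    ∀ a : A, φ (s.inv a) = t.inv (φ a)

/-- The indeterminates `x_{i,g}` and `x_{i,g}^*`, for `i ∈ ℕ` and `g ∈ G`. -/
inductive GStarVar (G : Type*) where
  | x (i : ℕ) (g : G) : GStarVar G
  | xstar (i : ℕ) (g : G) : GStarVar G

/-- The free algebra `F_{G,*}⟨X⟩` on the indeterminates `x_{i,g}` and `x_{i,g}^*`. -/
abbrev GStarFree (F G : Type*) [Field F] : Type _ := FreeAlgebra F (GStarVar G)

/-- Evaluation of `(G, *)`-polynomials in an algebra with involution `s`:
`x_{i,g}` is replaced by `a i g` and `x_{i,g}^*` by the image of `a i g` under `s`. -/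
def GradedInvolution.eval {F A G : Type*} [Field F] [Ring A] [Algebra F A] [Group G]
    {𝒰 : GroupGrading F A G} (s : GradedInvolution 𝒰) (a : ℕ → G → A) :
    GStarFree F G →ₐ[F] A :=
  FreeAlgebra.lift F fun v : GStarVar G =>
    match v with
    | GStarVar.x i g => a i g
    | GStarVar.xstar i g => s.inv (a i g)

/-- The set `T_{G,*}(A)` of `(G, *)`-identities: the polynomials that vanish under every
substitution of each `x_{i,g}` by a homogeneous element of degree `g`. -/
def GradedInvolution.identities {F A G : Type*} [Field F] [Ring A] [Algebra F A] [Group G]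
    {𝒰 : GroupGrading F A G} (s : GradedInvolution 𝒰) : Set (GStarFree F G) :=
  {f | ∀ a : ℕ → G → A, (∀ i g, a i g ∈ 𝒰.comp g) → s.eval a f = 0}

/-! Isomorphic algebras have the same identities; the converse recovers three invariants from the
identities: the matrix size, the degrees along the superdiagonal, and a sign. Let J be the strictly
upper triangular part. A graded involution reverses products, so homogeneous elements with nonzero
product have commuting degrees and commutators of homogeneous elements are homogeneous. Since J is
spanned by commutators, J is graded, and so are the first row and the column filtration, both
definable from J. A homogeneous basis of the first row adapted to that filtration gives a triangular
change of basis making all matrix units homogeneous (`UT.exists_isElementary_map`). The degrees of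
the units e_{l,l+1} determine such a grading. On `UT (k + 1) F` a product of more than k of the
commutators in `GStarFree.commProd` vanishes. A product of k takes values in the corner line and is
nonzero only for the degree sequence of the superdiagonal. The involution acts on the corner by η =
±1, and for this product f the polynomial f* - μf is an identity exactly when μ = η. For one
elementary grading, two involutions differ by conjugation by some p of degree 1. Equal signs force p
to be symmetric; a square root of p that is a polynomial in p is then symmetric of degree 1, and
conjugation by it is the isomorphism (`UT.gStarIsomorphic_of_sign_eq`). -/

section Grading

variable {F A B G : Type*} [Field F] [Ring A] [Algebra F A] [Ring B] [Algebra F B] [Group G]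

/-! ### Homogeneous components of a graded algebra. -/

namespace GroupGrading

@[ext]
theorem ext {𝒰 𝒱 : GroupGrading F A G} (h : ∀ g, 𝒰.comp g = 𝒱.comp g) : 𝒰 = 𝒱 := by
  cases 𝒰; cases 𝒱
  congr
  exact funext h

variable (𝒰 : GroupGrading F A G)

open Classical in
theorem isInternal : DirectSum.IsInternal 𝒰.comp :=
  DirectSum.isInternal_submodule_of_iSupIndep_of_iSup_eq_top 𝒰.indep 𝒰.iSup_eq_top

open Classical in
/-- The decomposition of an algebra into its homogeneous components. -/
noncomputable def decomp : A ≃ₗ[F] DirectSum G fun g => 𝒰.comp g :=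
  (LinearEquiv.ofBijective (DirectSum.coeLinearMap 𝒰.comp) 𝒰.isInternal).symm

/-- The projection onto a homogeneous component. -/
noncomputable def proj (g : G) : A →ₗ[F] A :=
  (𝒰.comp g).subtype ∘ₗ DirectSum.component F G (fun g => 𝒰.comp g) g ∘ₗ
    𝒰.decomp.toLinearMap

theorem proj_mem (g : G) (a : A) : 𝒰.proj g a ∈ 𝒰.comp g := by
  simp [proj]

open Classical in
theorem decomp_of_mem {g : G} {a : A} (ha : a ∈ 𝒰.comp g) :
    𝒰.decomp a = DirectSum.lof F G (fun g => 𝒰.comp g) g ⟨a, ha⟩ := by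
  rw [decomp, LinearEquiv.symm_apply_eq]
  exact (DirectSum.coeLinearMap_lof 𝒰.comp g ⟨a, ha⟩).symm

theorem proj_of_mem {g : G} {a : A} (ha : a ∈ 𝒰.comp g) : 𝒰.proj g a = a := by
  classical
  simp [proj, 𝒰.decomp_of_mem ha]

theorem proj_of_mem_ne {g h : G} {a : A} (ha : a ∈ 𝒰.comp h) (hgh : h ≠ g) :
    𝒰.proj g a = 0 := by
  classical
  simp [proj, 𝒰.decomp_of_mem ha, DirectSum.component.of, hgh]

theorem mem_of_proj_mem (S : Submodule F A) {a : A} (h : ∀ g, 𝒰.proj g a ∈ S) : a ∈ S := by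
  classical
  have ha : a = DirectSum.coeLinearMap 𝒰.comp (𝒰.decomp a) := by
    conv_lhs => rw [← 𝒰.decomp.symm_apply_apply a]
    rfl
  rw [ha, DirectSum.coeLinearMap_eq_dfinsuppSum]
  exact Submodule.dfinsuppSum_mem _ _ _ fun g _ => h g

theorem mem_comp_of_proj {g : G} {a : A} (h : ∀ u, u ≠ g → 𝒰.proj u a = 0) :
    a ∈ 𝒰.comp g := by
  refine 𝒰.mem_of_proj_mem _ fun u => ?_
  by_cases hu : u = g
  · subst hu; exact 𝒰.proj_mem _ _
  · rw [h u hu]; exact Submodule.zero_mem _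

theorem eq_of_mem_of_mem {g h : G} {a : A} (hg : a ∈ 𝒰.comp g) (hh : a ∈ 𝒰.comp h)
    (ha : a ≠ 0) : g = h := by
  by_contra hne
  exact ha ((𝒰.proj_of_mem hg).symm.trans (𝒰.proj_of_mem_ne hh (Ne.symm hne)))

theorem induction_homogeneous {p : A → Prop} (a : A) (hom : ∀ g, ∀ x ∈ 𝒰.comp g, p x)
    (add : ∀ x y, p x → p y → p (x + y)) (zero : p 0) : p a :=
  Submodule.iSup_induction 𝒰.comp (motive := p) (by rw [𝒰.iSup_eq_top]; exact Submodule.mem_top) hom zero add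

/-- Cancellation in G: right multiplication by an element of degree h shifts degrees injectively, so
components do not mix. -/
theorem proj_mul_right {g h : G} (a : A) {b : A} (hb : b ∈ 𝒰.comp h) :
    𝒰.proj (g * h) (a * b) = 𝒰.proj g a * b := by
  induction a using 𝒰.induction_homogeneous with
  | hom u x hx =>
    by_cases hu : u = g
    · subst hu
      rw [𝒰.proj_of_mem hx, 𝒰.proj_of_mem (𝒰.mul_mem hx hb)]
    · rw [𝒰.proj_of_mem_ne hx hu, 𝒰.proj_of_mem_ne (𝒰.mul_mem hx hb) (by simpa using hu),
        zero_mul]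
  | add x y hx hy => rw [add_mul, map_add, map_add, hx, hy, add_mul]
  | zero => simp

theorem proj_mul_left {g h : G} (a : A) {b : A} (hb : b ∈ 𝒰.comp h) :
    𝒰.proj (h * g) (b * a) = b * 𝒰.proj g a := by
  induction a using 𝒰.induction_homogeneous with
  | hom u x hx =>
    by_cases hu : u = g
    · subst hu
      rw [𝒰.proj_of_mem hx, 𝒰.proj_of_mem (𝒰.mul_mem hb hx)]
    · rw [𝒰.proj_of_mem_ne hx hu, 𝒰.proj_of_mem_ne (𝒰.mul_mem hb hx) (by simpa using hu),
        mul_zero]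
  | add x y hx hy => rw [mul_add, map_add, map_add, hx, hy, mul_add]
  | zero => simp

/-- The grading transported along an isomorphism of algebras. -/
def map (φ : A ≃ₐ[F] B) : GroupGrading F B G where
  comp g := (𝒰.comp g).map φ.toLinearMap
  indep := 𝒰.indep.map_orderIso (Submodule.orderIsoMapComap φ.toLinearEquiv)
  iSup_eq_top := by
    rw [← Submodule.map_iSup, 𝒰.iSup_eq_top, Submodule.map_top]
    exact LinearMap.range_eq_top.2 φ.surjective
  mul_mem := by
    rintro g h _ _ ⟨a, ha, rfl⟩ ⟨b, hb, rfl⟩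
    exact ⟨a * b, 𝒰.mul_mem ha hb, map_mul φ a b⟩

theorem mem_map_comp {φ : A ≃ₐ[F] B} {g : G} {b : B} :
    b ∈ (𝒰.map φ).comp g ↔ φ.symm b ∈ 𝒰.comp g := by
  constructor
  · rintro ⟨a, ha, rfl⟩
    simpa using ha
  · intro h
    exact ⟨_, h, φ.apply_symm_apply b⟩

end GroupGrading

/-! ### Graded involutions and degrees of commutators. -/

namespace GradedInvolution

variable {𝒰 : GroupGrading F A G}

theorem inv_one (s : GradedInvolution 𝒰) : s.inv 1 = 1 := by
  have h := s.inv_mul (s.inv 1) 1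
  rw [mul_one, s.inv_inv, mul_one] at h
  exact h.symm

theorem inv_pow (s : GradedInvolution 𝒰) (a : A) (n : ℕ) : s.inv (a ^ n) = s.inv a ^ n := by
  induction n with
  | zero => simp [s.inv_one]
  | succ n ih => rw [pow_succ, s.inv_mul, ih, pow_succ']

open Polynomial in
theorem inv_aeval (s : GradedInvolution 𝒰) (a : A) (f : F[X]) :
    s.inv (aeval a f) = aeval (s.inv a) f := by
  simp [aeval_eq_sum_range, s.inv_pow]

/-- The graded involution transported along an isomorphism of algebras. -/
def map (s : GradedInvolution 𝒰) (φ : A ≃ₐ[F] B) : GradedInvolution (𝒰.map φ) where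
  inv := φ.toLinearMap ∘ₗ s.inv ∘ₗ φ.symm.toLinearMap
  inv_inv a := by simp [s.inv_inv]
  inv_mul a b := by simp [s.inv_mul]
  inv_mem {g a} ha := by
    rw [𝒰.mem_map_comp] at ha ⊢
    simpa using s.inv_mem ha

theorem gStarIsomorphic_map (s : GradedInvolution 𝒰) (φ : A ≃ₐ[F] B) :
    GStarIsomorphic s (s.map φ) :=
  ⟨φ, fun g a ha => ⟨a, ha, rfl⟩, fun a => by simp [map]⟩

/-- The composition of two graded involutions, as an automorphism of the algebra. -/
def comp (t s : GradedInvolution 𝒰) : A ≃ₐ[F] A :=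
  AlgEquiv.ofLinearEquiv
    { t.inv ∘ₗ s.inv with
      invFun := fun a => s.inv (t.inv a)
      left_inv := fun a => by simp [s.inv_inv, t.inv_inv]
      right_inv := fun a => by simp [s.inv_inv, t.inv_inv] }
    (by simp [s.inv_one, t.inv_one])
    (fun a b => by simp [s.inv_mul, t.inv_mul])

theorem comp_apply (t s : GradedInvolution 𝒰) (a : A) : t.comp s a = t.inv (s.inv a) := rfl

/-- Products of homogeneous elements with a nonzero value have commuting degrees, because a
graded involution reverses products. -/
theorem degree_mul_comm (s : GradedInvolution 𝒰) {g h : G} {a b : A} (ha : a ∈ 𝒰.comp g)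
    (hb : b ∈ 𝒰.comp h) (hab : a * b ≠ 0) : g * h = h * g := by
  refine 𝒰.eq_of_mem_of_mem (s.inv_mem (𝒰.mul_mem ha hb)) ?_ fun h0 => hab ?_
  · rw [s.inv_mul]
    exact 𝒰.mul_mem (s.inv_mem hb) (s.inv_mem ha)
  · rw [← s.inv_inv (a * b), h0, map_zero]

/-- Either ba vanishes, or the involution forces gh = hg; this replaces commutativity of G. -/
theorem commutator_mem (s : GradedInvolution 𝒰) {g h : G} {a b : A} (ha : a ∈ 𝒰.comp g)
    (hb : b ∈ 𝒰.comp h) : a * b - b * a ∈ 𝒰.comp (g * h) := by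
  by_cases hba : b * a = 0
  · rw [hba, sub_zero]; exact 𝒰.mul_mem ha hb
  · refine Submodule.sub_mem _ (𝒰.mul_mem ha hb) ?_
    rw [← s.degree_mul_comm hb ha hba]
    exact 𝒰.mul_mem hb ha

/-- Homogeneous components of a commutator are sums of commutators. -/
theorem proj_commutator_mem (s : GradedInvolution 𝒰) (S : Submodule F A)
    (hS : ∀ a b : A, a * b - b * a ∈ S) (u : G) (a b : A) : 𝒰.proj u (a * b - b * a) ∈ S := by
  induction a using 𝒰.induction_homogeneous with
  | hom g a ha =>
    induction b using 𝒰.induction_homogeneous with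
    | hom h b hb =>
      by_cases hu : g * h = u
      · subst hu
        rw [𝒰.proj_of_mem (s.commutator_mem ha hb)]
        exact hS a b
      · rw [𝒰.proj_of_mem_ne (s.commutator_mem ha hb) hu]
        exact S.zero_mem
    | add x y hx hy =>
      have : a * (x + y) - (x + y) * a = (a * x - x * a) + (a * y - y * a) := by
        noncomm_ring
      rw [this, map_add]
      exact S.add_mem hx hy
    | zero => simp
  | add x y hx hy =>
    have : (x + y) * b - b * (x + y) = (x * b - b * x) + (y * b - b * y) := by
      noncomm_ring
    rw [this, map_add]
    exact S.add_mem hx hy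
  | zero => simp

theorem eval_x (s : GradedInvolution 𝒰) (a : ℕ → G → A) (i : ℕ) (g : G) :
    s.eval a (FreeAlgebra.ι F (GStarVar.x i g)) = a i g := by
  simp [eval]

theorem eval_xstar (s : GradedInvolution 𝒰) (a : ℕ → G → A) (i : ℕ) (g : G) :
    s.eval a (FreeAlgebra.ι F (GStarVar.xstar i g)) = s.inv (a i g) := by
  simp [eval]

end GradedInvolution

variable {C : Type*} [Ring C] [Algebra F C]
  {𝒰 : GroupGrading F A G} {𝒱 : GroupGrading F B G} {𝒲 : GroupGrading F C G}
  {s : GradedInvolution 𝒰} {t : GradedInvolution 𝒱} {r : GradedInvolution 𝒲}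

/-! ### Isomorphisms and transfer of identities. -/

namespace GStarIsomorphic

theorem symm (h : GStarIsomorphic s t) : GStarIsomorphic t s := by
  obtain ⟨φ, hφ, hst⟩ := h
  -- Only the inclusion of φ(A_g) in B_g is given; compatibility with projections supplies the
  -- reverse inclusion.
  have key : ∀ g a, φ (𝒰.proj g a) = 𝒱.proj g (φ a) := by
    intro g a
    induction a using 𝒰.induction_homogeneous with
    | hom u x hx =>
      by_cases hu : u = g
      · subst hu
        rw [𝒰.proj_of_mem hx, 𝒱.proj_of_mem (hφ _ _ hx)]
      · rw [𝒰.proj_of_mem_ne hx hu, 𝒱.proj_of_mem_ne (hφ _ _ hx) hu, map_zero]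
    | add x y hx hy => simp only [map_add, hx, hy]
    | zero => simp
  refine ⟨φ.symm, fun g b hb => ?_, fun b => ?_⟩
  · have h1 := key g (φ.symm b)
    rw [φ.apply_symm_apply, 𝒱.proj_of_mem hb] at h1
    rw [← h1, φ.symm_apply_apply]
    exact 𝒰.proj_mem _ _
  · rw [φ.symm_apply_eq, hst, φ.apply_symm_apply]

theorem trans (h : GStarIsomorphic s t) (h' : GStarIsomorphic t r) : GStarIsomorphic s r := by
  obtain ⟨φ, hφ, hst⟩ := h
  obtain ⟨ψ, hψ, htr⟩ := h'
  exact ⟨φ.trans ψ, fun g a ha => hψ g _ (hφ g a ha), fun a => by simp [hst, htr]⟩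

theorem identities_subset (h : GStarIsomorphic s t) : t.identities ⊆ s.identities := by
  obtain ⟨φ, hφ, hst⟩ := h
  intro f hf a ha
  have h1 : (φ : A →ₐ[F] B).comp (s.eval a) = t.eval fun i g => φ (a i g) := by
    ext v
    cases v <;> simp [GradedInvolution.eval, hst]
  have h2 := hf (fun i g => φ (a i g)) fun i g => hφ g _ (ha i g)
  rw [← h1] at h2
  simpa using h2

theorem identities_eq (h : GStarIsomorphic s t) : s.identities = t.identities :=
  Set.Subset.antisymm h.symm.identities_subset h.identities_subset

end GStarIsomorphic

/-- The formal involution of the free algebra exchanging `x_{i,g}` and `x_{i,g}^*`. -/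
noncomputable def GStarFree.star (F G : Type*) [Field F] :
    GStarFree F G →ₐ[F] (GStarFree F G)ᵐᵒᵖ :=
  FreeAlgebra.lift F fun v : GStarVar G =>
    match v with
    | GStarVar.x i g => MulOpposite.op (FreeAlgebra.ι F (GStarVar.xstar i g))
    | GStarVar.xstar i g => MulOpposite.op (FreeAlgebra.ι F (GStarVar.x i g))

/-- Lets a polynomial identity express how the involution acts on the values of f. -/
theorem GradedInvolution.eval_star (s : GradedInvolution 𝒰) (a : ℕ → G → A)
    (f : GStarFree F G) :
    s.eval a (GStarFree.star F G f).unop = s.inv (s.eval a f) := by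
  induction f using FreeAlgebra.induction with
  | grade0 r => simp [Algebra.algebraMap_eq_smul_one, s.inv_one]
  | grade1 v => cases v <;> simp [GStarFree.star, eval_x, eval_xstar, s.inv_inv]
  | mul p q hp hq => simp [hp, hq, s.inv_mul]
  | add p q hp hq => simp [hp, hq]

end Grading

/-! ### Matrix units, the strictly triangular part and the column filtration. -/

namespace UT

section Basic

variable {F : Type*} [Field F] {m : ℕ}

theorem apply_eq_zero (a : UT m F) {i j : Fin m} (h : j < i) : a.1 i j = 0 := a.2 h

theorem ext_apply {a b : UT m F} (h : ∀ i j, a.1 i j = b.1 i j) : a = b :=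
  Subtype.ext (Matrix.ext h)

theorem exists_apply_ne_zero {a : UT m F} (h : a ≠ 0) : ∃ i j, a.1 i j ≠ 0 := by
  by_contra! h'
  exact h (ext_apply h')

theorem mul_apply (a b : UT m F) (i j : Fin m) : (a * b).1 i j = ∑ r, a.1 i r * b.1 r j :=
  Matrix.mul_apply

theorem add_apply (a b : UT m F) (i j : Fin m) : (a + b).1 i j = a.1 i j + b.1 i j := rfl

theorem sub_apply (a b : UT m F) (i j : Fin m) : (a - b).1 i j = a.1 i j - b.1 i j := rfl

theorem smul_apply (c : F) (a : UT m F) (i j : Fin m) : (c • a).1 i j = c * a.1 i j := rfl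

theorem mul_apply_self (a b : UT m F) (i : Fin m) : (a * b).1 i i = a.1 i i * b.1 i i := by
  rw [mul_apply]
  refine Finset.sum_eq_single i (fun r _ hr => ?_) (by simp)
  rcases lt_or_gt_of_ne hr with h | h
  · rw [apply_eq_zero a h, zero_mul]
  · rw [apply_eq_zero b h, mul_zero]

/-- The matrix unit `e_{ij}` for `i ≤ j`, and zero otherwise. -/
def unit (F : Type*) [Field F] {m : ℕ} (i j : Fin m) : UT m F :=
  if h : i ≤ j then ⟨Matrix.single i j 1,
    Matrix.mem_blockTriangularSubalgebra.2 (Matrix.blockTriangular_single h 1)⟩ else 0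

theorem unit_apply (i j r l : Fin m) :
    (unit F i j).1 r l = if i ≤ j ∧ r = i ∧ l = j then 1 else 0 := by
  unfold unit
  split_ifs with h h1 h1
  · simp [h1.2.1, h1.2.2]
  · change Matrix.single i j (1 : F) r l = 0
    rw [Matrix.single_apply]
    exact if_neg fun h2 => h1 ⟨h, h2.1.symm, h2.2.symm⟩
  · exact absurd h1.1 h
  · rfl

theorem unit_mul_apply (i j r l : Fin m) (a : UT m F) :
    (unit F i j * a).1 r l = if i ≤ j ∧ r = i then a.1 j l else 0 := by
  rw [mul_apply]
  simp only [unit_apply]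
  by_cases h : i ≤ j ∧ r = i
  · simp [h.1, h.2]
  · rw [if_neg h]
    refine Finset.sum_eq_zero fun x _ => ?_
    rw [if_neg fun h' => h ⟨h'.1, h'.2.1⟩, zero_mul]

theorem mul_unit_apply (i j r l : Fin m) (a : UT m F) :
    (a * unit F i j).1 r l = if i ≤ j ∧ l = j then a.1 r i else 0 := by
  rw [mul_apply]
  simp only [unit_apply]
  by_cases h : i ≤ j ∧ l = j
  · simp [h.1, h.2]
  · rw [if_neg h]
    refine Finset.sum_eq_zero fun x _ => ?_
    rw [if_neg fun h' => h ⟨h'.1, h'.2.2⟩, mul_zero]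

theorem unit_mul_unit {i j l : Fin m} (hij : i ≤ j) (hjl : j ≤ l) :
    unit F i j * unit F j l = unit F i l := by
  apply ext_apply
  intro r c
  rw [unit_mul_apply, unit_apply, unit_apply]
  split_ifs <;> grind

theorem unit_mul_unit_of_ne {i j j' l : Fin m} (h : j ≠ j') :
    unit F i j * unit F j' l = 0 := by
  apply ext_apply
  intro r c
  rw [unit_mul_apply, unit_apply]
  simp [h]

theorem unit_ne_zero {i j : Fin m} (hij : i ≤ j) : unit F i j ≠ 0 := by
  intro h
  have := unit_apply (F := F) i j i j
  rw [h] at this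
  simp [hij] at this

theorem unit_mul_mul_unit {i j : Fin m} (hij : i ≤ j) (a : UT m F) :
    unit F i i * a * unit F j j = a.1 i j • unit F i j := by
  apply ext_apply
  intro r l
  rw [mul_unit_apply, unit_mul_apply, smul_apply, unit_apply]
  split_ifs <;> grind

theorem eq_sum_unit (a : UT m F) : a = ∑ i, ∑ j, a.1 i j • unit F i j := by
  apply ext_apply
  intro r l
  have h : (∑ i, ∑ j, a.1 i j • unit F i j).1 r l
      = ∑ i, ∑ j, a.1 i j * (unit F i j).1 r l := by
    rw [AddSubmonoidClass.coe_finsetSum, Matrix.sum_apply]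
    refine Finset.sum_congr rfl fun i _ => ?_
    rw [AddSubmonoidClass.coe_finsetSum, Matrix.sum_apply]
    rfl
  rw [h, Finset.sum_eq_single r, Finset.sum_eq_single l]
  · rw [unit_apply]
    by_cases hrl : r ≤ l
    · simp [hrl]
    · rw [apply_eq_zero a (not_le.1 hrl), zero_mul]
  · intro j _ hj
    rw [unit_apply, if_neg (by grind), mul_zero]
  · simp
  · intro i _ hi
    refine Finset.sum_eq_zero fun j _ => ?_
    rw [unit_apply, if_neg (by grind), mul_zero]
  · simp

theorem mul_eq_one_comm {a b : UT m F} : a * b = 1 ↔ b * a = 1 := by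
  rw [Subtype.ext_iff, Subtype.ext_iff]
  exact _root_.mul_eq_one_comm (a := a.1) (b := b.1)

/-- Upper triangular matrices with zero diagonal. -/
def strict (m : ℕ) (F : Type*) [Field F] : Submodule F (UT m F) where
  carrier := {a | ∀ i, a.1 i i = 0}
  add_mem' ha hb i := by rw [add_apply, ha i, hb i, add_zero]
  zero_mem' _ := rfl
  smul_mem' c a ha i := by rw [smul_apply, ha i, mul_zero]

theorem lt_of_mem_strict {a : UT m F} (ha : a ∈ strict m F) {i j : Fin m}
    (h : a.1 i j ≠ 0) : i < j := by
  by_contra hij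
  rcases (not_lt.1 hij).lt_or_eq with h1 | h1
  · exact h (apply_eq_zero a h1)
  · exact h (h1 ▸ ha j)

theorem commutator_mem_strict (a b : UT m F) : a * b - b * a ∈ strict m F := by
  intro i
  rw [sub_apply, mul_apply_self, mul_apply_self, mul_comm, sub_self]

theorem unit_mem_strict {i j : Fin m} (hij : i < j) : unit F i j ∈ strict m F := by
  intro r
  rw [unit_apply, if_neg (by grind)]

theorem unit_eq_commutator {i j : Fin m} (hij : i < j) :
    unit F i j = unit F i i * unit F i j - unit F i j * unit F i i := by
  rw [unit_mul_unit le_rfl hij.le, unit_mul_unit_of_ne hij.ne', sub_zero]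

/-- Linear maps sending commutators into a submodule send every strictly upper triangular
matrix into it. -/
theorem map_mem_of_mem_strict {M : Type*} [AddCommGroup M] [Module F M] (T : UT m F →ₗ[F] M)
    (S : Submodule F M) (hT : ∀ a b, T (a * b - b * a) ∈ S) {a : UT m F}
    (ha : a ∈ strict m F) : T a ∈ S := by
  rw [eq_sum_unit a, map_sum]
  refine S.sum_mem fun i _ => ?_
  rw [map_sum]
  refine S.sum_mem fun j _ => ?_
  rw [map_smul]
  by_cases h : a.1 i j = 0
  · rw [h, zero_smul]; exact S.zero_mem
  · rw [unit_eq_commutator (lt_of_mem_strict ha h)]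
    exact S.smul_mem _ (hT _ _)

/-- The strictly triangular part is the span of the commutators, hence characteristic. -/
theorem algEquiv_mem_strict (φ : UT m F ≃ₐ[F] UT m F) {a : UT m F} (ha : a ∈ strict m F) :
    φ a ∈ strict m F := by
  refine map_mem_of_mem_strict φ.toLinearMap _ (fun a b => ?_) ha
  simp only [AlgEquiv.toLinearMap_apply, map_sub, map_mul]
  exact commutator_mem_strict _ _

theorem _root_.GradedInvolution.mem_strict {G : Type*} [Group G]
    {𝒰 : GroupGrading F (UT m F) G} (s : GradedInvolution 𝒰) {a : UT m F}
    (ha : a ∈ strict m F) : s.inv a ∈ strict m F := by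
  refine map_mem_of_mem_strict s.inv _ (fun a b => ?_) ha
  simp only [map_sub, s.inv_mul]
  exact commutator_mem_strict _ _

theorem _root_.GradedInvolution.proj_mem_strict {G : Type*} [Group G]
    {𝒰 : GroupGrading F (UT m F) G} (s : GradedInvolution 𝒰) (g : G) {a : UT m F}
    (ha : a ∈ strict m F) : 𝒰.proj g a ∈ strict m F :=
  map_mem_of_mem_strict _ _ (s.proj_commutator_mem _ commutator_mem_strict g) ha

/-- Upper triangular matrices whose columns before the `r`-th are zero. -/
def colsFrom (m : ℕ) (F : Type*) [Field F] (r : ℕ) : Submodule F (UT m F) where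
  carrier := {a | ∀ i j : Fin m, (j : ℕ) < r → a.1 i j = 0}
  add_mem' ha hb i j h := by rw [add_apply, ha i j h, hb i j h, add_zero]
  zero_mem' _ _ _ := rfl
  smul_mem' c a ha i j h := by rw [smul_apply, ha i j h, mul_zero]

/-- Describes the column filtration by J alone, descending from zero at r = m; it therefore inherits
invariance and homogeneity from J. -/
theorem mem_colsFrom_iff_mul {r : ℕ} (hr : r < m) {a : UT m F} :
    a ∈ colsFrom m F r ↔ ∀ c ∈ strict m F, a * c ∈ colsFrom m F (r + 1) := by
  constructor
  · intro ha c hc i j hj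
    rw [mul_apply]
    refine Finset.sum_eq_zero fun x _ => ?_
    by_cases hcx : c.1 x j = 0
    · rw [hcx, mul_zero]
    · have := lt_of_mem_strict hc hcx
      rw [ha i x (by omega), zero_mul]
  · intro h i j hj
    have h1 := h _ (unit_mem_strict (F := F) (i := j) (j := ⟨r, hr⟩) hj) i ⟨r, hr⟩
      (Nat.lt_succ_self r)
    rwa [mul_unit_apply, if_pos ⟨le_of_lt hj, rfl⟩] at h1

theorem algEquiv_mem_colsFrom (φ : UT m F ≃ₐ[F] UT m F) {r : ℕ} (hr : r ≤ m) {a : UT m F}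
    (ha : a ∈ colsFrom m F r) : φ a ∈ colsFrom m F r := by
  induction hr using Nat.decreasingInduction generalizing a with
  | of_succ r hr ih =>
    rw [mem_colsFrom_iff_mul hr] at ha ⊢
    intro c hc
    rw [← φ.apply_symm_apply c, ← map_mul]
    exact ih (ha _ (algEquiv_mem_strict φ.symm hc))
  | self =>
    have : a = 0 := ext_apply fun i j => ha i j j.2
    rw [this, map_zero]
    exact Submodule.zero_mem _

theorem _root_.GradedInvolution.proj_mem_colsFrom {G : Type*} [Group G]
    {𝒰 : GroupGrading F (UT m F) G} (s : GradedInvolution 𝒰) {r : ℕ} (hr : r ≤ m) (g : G)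
    {a : UT m F} (ha : a ∈ colsFrom m F r) : 𝒰.proj g a ∈ colsFrom m F r := by
  induction hr using Nat.decreasingInduction generalizing a g with
  | of_succ r hr ih =>
    rw [mem_colsFrom_iff_mul hr] at ha ⊢
    intro c hc
    refine 𝒰.mem_of_proj_mem
      ((colsFrom m F (r + 1)).comap (LinearMap.mulLeft F (𝒰.proj g a))) fun h => ?_
    rw [Submodule.mem_comap, LinearMap.mulLeft_apply,
      ← 𝒰.proj_mul_right a (𝒰.proj_mem h c)]
    exact ih _ (ha _ (s.proj_mem_strict h hc))
  | self =>
    have : a = 0 := ext_apply fun i j => ha i j j.2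
    rw [this, map_zero]
    exact Submodule.zero_mem _

end Basic

/-! ### The first row as a faithful right module; automorphisms. -/

section Rows

variable {F : Type*} [Field F] {k : ℕ}

/-- Upper triangular matrices in which only the first row may be nonzero. -/
def firstRow (k : ℕ) (F : Type*) [Field F] : Submodule F (UT (k + 1) F) where
  carrier := {a | ∀ i j, i ≠ 0 → a.1 i j = 0}
  add_mem' ha hb i j h := by rw [add_apply, ha i j h, hb i j h, add_zero]
  zero_mem' _ _ _ := rfl
  smul_mem' c a ha i j h := by rw [smul_apply, ha i j h, mul_zero]

/-- The first row is the right annihilator of J, so it too is characteristic and graded. -/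
theorem mem_firstRow_iff_mul {a : UT (k + 1) F} :
    a ∈ firstRow k F ↔ ∀ c ∈ strict (k + 1) F, c * a = 0 := by
  constructor
  · intro ha c hc
    apply ext_apply
    intro i j
    rw [mul_apply]
    refine Finset.sum_eq_zero fun x _ => ?_
    by_cases hcx : c.1 i x = 0
    · rw [hcx, zero_mul]
    · have := lt_of_mem_strict hc hcx
      rw [ha x j (by grind), mul_zero]
  · intro h i j hi
    have h1 := h _ (unit_mem_strict (F := F) (i := 0) (j := i) (Fin.pos_of_ne_zero hi))
    have h2 := unit_mul_apply 0 i 0 j a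
    rw [h1, if_pos ⟨Fin.zero_le i, rfl⟩] at h2
    exact h2.symm

theorem unit_mem_firstRow (i : Fin (k + 1)) : unit F 0 i ∈ firstRow k F := by
  intro r l hr
  rw [unit_apply, if_neg (by grind)]

theorem unit_mem_colsFrom (i : Fin (k + 1)) : unit F 0 i ∈ colsFrom (k + 1) F i := by
  intro r l hl
  rw [unit_apply, if_neg (by grind)]

theorem algEquiv_mem_firstRow (φ : UT (k + 1) F ≃ₐ[F] UT (k + 1) F) {a : UT (k + 1) F}
    (ha : a ∈ firstRow k F) : φ a ∈ firstRow k F := by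
  rw [mem_firstRow_iff_mul] at ha ⊢
  intro c hc
  rw [← φ.apply_symm_apply c, ← map_mul, ha _ (algEquiv_mem_strict φ.symm hc), map_zero]

theorem _root_.GradedInvolution.proj_mem_firstRow {G : Type*} [Group G]
    {𝒰 : GroupGrading F (UT (k + 1) F) G} (s : GradedInvolution 𝒰) (g : G)
    {a : UT (k + 1) F} (ha : a ∈ firstRow k F) : 𝒰.proj g a ∈ firstRow k F := by
  rw [mem_firstRow_iff_mul] at ha ⊢
  intro c hc
  refine LinearMap.mem_ker.1 (𝒰.mem_of_proj_mem
    (LinearMap.ker (LinearMap.mulRight F (𝒰.proj g a))) fun h => ?_)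
  rw [LinearMap.mem_ker, LinearMap.mulRight_apply, ← 𝒰.proj_mul_left a (𝒰.proj_mem h c),
    ha _ (s.proj_mem_strict h hc), map_zero]

/-- Multiplying by e_{0i} copies row i of a into row 0: the action on the first row is faithful. -/
theorem eq_zero_of_unit_mul {a : UT (k + 1) F} (h : ∀ i, unit F 0 i * a = 0) : a = 0 := by
  apply ext_apply
  intro i j
  have h1 := unit_mul_apply 0 i 0 j a
  rw [h i, if_pos ⟨Fin.zero_le i, rfl⟩] at h1
  exact h1.symm

/-- The matrix whose `i`-th row is the first row of `v i`. -/
def ofFirstRows (v : Fin (k + 1) → UT (k + 1) F)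
    (hv : ∀ i : Fin (k + 1), v i ∈ colsFrom (k + 1) F i) : UT (k + 1) F :=
  ⟨Matrix.of fun i j => (v i).1 0 j, fun i j h => hv i 0 j h⟩

theorem unit_mul_ofFirstRows {v : Fin (k + 1) → UT (k + 1) F}
    (hv : ∀ i : Fin (k + 1), v i ∈ colsFrom (k + 1) F i) (hr : ∀ i, v i ∈ firstRow k F)
    (i : Fin (k + 1)) : unit F 0 i * ofFirstRows v hv = v i := by
  apply ext_apply
  intro r l
  rw [unit_mul_apply]
  by_cases h : r = 0
  · subst h
    rw [if_pos ⟨Fin.zero_le i, rfl⟩]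
    rfl
  · rw [if_neg fun h' => h h'.2, hr i r l h]

/-- Every automorphism of `UT` is inner. -/
theorem exists_conj (φ : UT (k + 1) F ≃ₐ[F] UT (k + 1) F) :
    ∃ p q : UT (k + 1) F, p * q = 1 ∧ (∀ i, unit F 0 i * p = φ (unit F 0 i)) ∧
      ∀ a, φ a = q * a * p := by
  -- p is the matrix of ψ restricted to the first row; it is triangular because ψ preserves the
  -- column filtration.
  have key : ∀ ψ : UT (k + 1) F ≃ₐ[F] UT (k + 1) F, ∃ p : UT (k + 1) F,
      (∀ i, unit F 0 i * p = ψ (unit F 0 i)) ∧ ∀ v ∈ firstRow k F, v * p = ψ v := by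
    intro ψ
    have h := unit_mul_ofFirstRows (v := fun i => ψ (unit F 0 i))
      (fun i => algEquiv_mem_colsFrom ψ i.2.le (unit_mem_colsFrom i))
      (fun i => algEquiv_mem_firstRow ψ (unit_mem_firstRow i))
    refine ⟨_, h, fun v hv => ?_⟩
    conv_lhs => rw [eq_sum_unit v]
    conv_rhs => rw [eq_sum_unit v]
    simp only [map_sum, map_smul, Finset.sum_mul, smul_mul_assoc]
    refine Finset.sum_congr rfl fun i _ => Finset.sum_congr rfl fun j _ => ?_
    by_cases hi : i = 0
    · subst hi; rw [h j]
    · rw [hv i j hi, zero_smul, zero_smul]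
  obtain ⟨p, hp, hp'⟩ := key φ
  obtain ⟨q, hq, hq'⟩ := key φ.symm
  have hqp : q * p = 1 := by
    rw [← sub_eq_zero]
    refine eq_zero_of_unit_mul fun i => ?_
    rw [mul_sub, ← mul_assoc, hq, mul_one, hp' _ (algEquiv_mem_firstRow φ.symm
      (unit_mem_firstRow i)), φ.apply_symm_apply, sub_self]
  -- On a first-row element v both sides act as φ(va) = φ(v)φ(a); faithfulness concludes.
  have hmul : ∀ a, a * p = p * φ a := by
    intro a
    rw [← sub_eq_zero]
    refine eq_zero_of_unit_mul fun i => ?_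
    have hmem : unit F 0 i * a ∈ firstRow k F := by
      intro r l hr
      rw [unit_mul_apply, if_neg fun h => hr h.2]
    rw [mul_sub, ← mul_assoc, ← mul_assoc, hp, hp' _ hmem, map_mul, sub_self]
  refine ⟨p, q, mul_eq_one_comm.1 hqp, hp, fun a => ?_⟩
  rw [mul_assoc, hmul, ← mul_assoc, hqp, one_mul]

end Rows

end UT

/-! ### Polynomial square roots of invertible elements. -/

section SquareRoot

open Polynomial

variable {F : Type*} [Field F] [IsAlgClosed F]

theorem exists_sq_add_mul_add_eq_zero (h2 : (2 : F) ≠ 0) (a b c : F) (h : a ≠ 0 ∨ b ≠ 0) :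
    ∃ x : F, a * x ^ 2 + b * x + c = 0 := by
  by_cases ha : a = 0
  · refine ⟨-c / b, ?_⟩
    have hb := h.resolve_left (not_not.2 ha)
    rw [ha]
    field_simp
    ring
  · obtain ⟨d, hd⟩ := IsAlgClosed.exists_pow_nat_eq (b ^ 2 - 4 * a * c) two_pos
    refine ⟨(d - b) / (2 * a), ?_⟩
    have h3 : a * ((d - b) / (2 * a)) ^ 2 + b * ((d - b) / (2 * a)) + c
        = (d ^ 2 - (b ^ 2 - 4 * a * c)) / (4 * a) := by
      have h4 : (4 : F) ≠ 0 := by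
        have : (4 : F) = 2 * 2 := by norm_num
        rw [this]
        exact mul_ne_zero h2 h2
      field_simp
      ring
    rw [h3, hd, sub_self, zero_div]

/-- Hensel-style lifting, one root at a time with multiplicity: replacing q by q + cP leaves a
quadratic condition on c at the new root l. It is solvable unless P(l) = q(l) = 0, which would give
l = 0. -/
theorem Multiset.exists_prod_X_sub_C_dvd_sq_sub_X (h2 : (2 : F) ≠ 0) (S : Multiset F)
    (hS : (0 : F) ∉ S) :
    ∃ q : F[X], (S.map fun x => X - C x).prod ∣ q ^ 2 - X := by
  induction S using Multiset.induction_on with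
  | empty => exact ⟨0, by simp⟩
  | cons l S ih =>
    rw [Multiset.mem_cons, not_or] at hS
    obtain ⟨q, r, hr⟩ := ih hS.2
    set P := (S.map fun x => X - C x).prod with hP
    obtain ⟨c, hc⟩ := exists_sq_add_mul_add_eq_zero h2 (P.eval l) (2 * q.eval l) (r.eval l) (by
      by_contra! h
      have h3 : q.eval l = 0 := (mul_eq_zero.1 h.2).resolve_left h2
      have h4 := congrArg (eval l) hr
      simp only [eval_sub, eval_pow, eval_X, eval_mul, h3, h.1, zero_mul] at h4
      exact hS.1 (by simpa [eq_comm] using h4))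
    refine ⟨q + C c * P, ?_⟩
    have h5 : X - C l ∣ P * C c ^ 2 + 2 * q * C c + r := by
      rw [dvd_iff_isRoot, IsRoot.def]
      simp only [eval_add, eval_mul, eval_pow, eval_C, eval_ofNat]
      exact hc
    have h6 : (q + C c * P) ^ 2 - X = (P * C c ^ 2 + 2 * q * C c + r) * P := by
      linear_combination hr
    rw [Multiset.map_cons, Multiset.prod_cons, h6]
    exact mul_dvd_mul_right h5 P

/-- Invertible elements of algebraic algebras have square roots that are polynomials in them. -/
theorem IsUnit.exists_aeval_sq_eq {A : Type*} [Ring A] [Algebra F A] (h2 : (2 : F) ≠ 0) {p : A}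
    (hp : IsUnit p) (hint : IsIntegral F p) : ∃ q : F[X], aeval p q ^ 2 = p := by
  -- If X divided the minimal polynomial, cancelling the unit p would leave an annihilating
  -- polynomial of smaller degree.
  have h0 : (0 : F) ∉ (minpoly F p).roots := by
    intro h
    obtain ⟨r, hr⟩ := dvd_iff_isRoot.2 (isRoot_of_mem_roots h)
    have h1 : aeval p r = 0 := by
      have := minpoly.aeval F p
      rw [hr] at this
      simp only [map_zero, sub_zero, map_mul, aeval_X] at this
      exact hp.mul_right_eq_zero.1 this
    have hr0 : r ≠ 0 := by
      rintro rfl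
      exact minpoly.ne_zero hint (by simpa using hr)
    have h3 := minpoly.degree_le_of_ne_zero F p hr0 h1
    rw [hr, degree_mul, degree_X_sub_C, degree_eq_natDegree hr0] at h3
    have h4 : 1 + r.natDegree ≤ r.natDegree := by exact_mod_cast h3
    omega
  obtain ⟨q, r, hr⟩ := Multiset.exists_prod_X_sub_C_dvd_sq_sub_X h2 _ h0
  refine ⟨q, ?_⟩
  rw [← (IsAlgClosed.splits (minpoly F p)).eq_prod_roots_of_monic (minpoly.monic hint)] at hr
  have h5 := congrArg (aeval p) hr
  rw [map_mul, minpoly.aeval, zero_mul, map_sub, map_pow, aeval_X] at h5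
  exact sub_eq_zero.1 h5

end SquareRoot

/-! ### Reduction to elementary gradings. -/

namespace UT

variable {F : Type*} [Field F] {k : ℕ} {G : Type*} [Group G]

theorem exists_mul_eq_one {m : ℕ} {p : UT m F} (hp : ∀ i, p.1 i i ≠ 0) :
    ∃ q : UT m F, p * q = 1 := by
  have hdet : IsUnit p.1.det := by
    rw [Matrix.det_of_isUpperTriangular p.2, isUnit_iff_ne_zero]
    exact Finset.prod_ne_zero_iff.2 fun i _ => hp i
  have := Matrix.invertibleOfIsUnitDet p.1 hdet
  exact ⟨⟨p.1⁻¹, Matrix.blockTriangular_inv_of_blockTriangular p.2⟩,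
    Subtype.ext (Matrix.mul_nonsing_inv p.1 hdet)⟩

/-- Conjugation `a ↦ q a p` by mutually inverse elements. -/
def conj {m : ℕ} (p q : UT m F) (hpq : p * q = 1) : UT m F ≃ₐ[F] UT m F :=
  AlgEquiv.ofLinearEquiv
    { LinearMap.mulLeft F q ∘ₗ LinearMap.mulRight F p with
      invFun := fun a => p * a * q
      left_inv := fun a => by
        change p * (q * (a * p)) * q = a
        rw [← mul_assoc, hpq, one_mul, mul_assoc, hpq, mul_one]
      right_inv := fun a => by
        change q * (p * a * q * p) = a
        rw [mul_assoc (p * a), mul_eq_one_comm.1 hpq, mul_one, ← mul_assoc,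
          mul_eq_one_comm.1 hpq, one_mul] }
    (by change q * (1 * p) = 1; rw [one_mul, mul_eq_one_comm.1 hpq])
    (fun a b => by
      change q * (a * b * p) = q * (a * p) * (q * (b * p))
      simp only [mul_assoc]
      rw [← mul_assoc p q, hpq, one_mul])

theorem conj_apply {m : ℕ} {p q : UT m F} (hpq : p * q = 1) (a : UT m F) :
    conj p q hpq a = q * (a * p) := rfl

theorem conj_symm_apply {m : ℕ} {p q : UT m F} (hpq : p * q = 1) (a : UT m F) :
    (conj p q hpq).symm a = p * a * q := rfl

/-- A grading is elementary when the matrix units are homogeneous, with degrees given by a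
sequence in the group. -/
def IsElementary (𝒰 : GroupGrading F (UT (k + 1) F) G) (h : ℕ → G) : Prop :=
  ∀ i j : Fin (k + 1), i ≤ j → unit F i j ∈ 𝒰.comp ((h i)⁻¹ * h j)

/-- The components of e_{0i} stay in the first row and in columns from i on; some component must
carry the nonzero entry at (0, i). -/
theorem exists_homogeneous_firstRow {𝒰 : GroupGrading F (UT (k + 1) F) G}
    (s : GradedInvolution 𝒰) (i : Fin (k + 1)) :
    ∃ g, ∃ v ∈ 𝒰.comp g, v ∈ firstRow k F ∧ v ∈ colsFrom (k + 1) F i ∧ v.1 0 i ≠ 0 := by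
  by_contra! hcon
  have h1 : unit F 0 i ∈ colsFrom (k + 1) F (i + 1) := by
    refine 𝒰.mem_of_proj_mem _ fun g => ?_
    have hr := s.proj_mem_firstRow g (unit_mem_firstRow (F := F) i)
    have hc := s.proj_mem_colsFrom i.2.le g (unit_mem_colsFrom (F := F) i)
    have h0 := hcon g _ (𝒰.proj_mem g _) hr hc
    intro r l hl
    rcases Nat.lt_succ_iff_lt_or_eq.1 hl with h | h
    · exact hc r l h
    · obtain rfl : l = i := Fin.ext h
      by_cases hr0 : r = 0
      · rw [hr0, h0]
      · exact hr r l hr0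
  have h2 := h1 0 i (Nat.lt_succ_self _)
  rw [unit_apply, if_pos ⟨Fin.zero_le i, rfl, rfl⟩] at h2
  exact one_ne_zero h2

/-- Every grading admitting a graded involution is isomorphic to an elementary one. -/
theorem exists_isElementary_map {𝒰 : GroupGrading F (UT (k + 1) F) G}
    (s : GradedInvolution 𝒰) :
    ∃ (φ : UT (k + 1) F ≃ₐ[F] UT (k + 1) F) (h : ℕ → G), IsElementary (𝒰.map φ) h := by
  choose g v hv hrow hcol hne using exists_homogeneous_firstRow s
  have hp := unit_mul_ofFirstRows hcol hrow
  obtain ⟨q, hpq⟩ := exists_mul_eq_one (p := ofFirstRows v hcol) hne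
  set p := ofFirstRows v hcol
  have hqp := mul_eq_one_comm.1 hpq
  -- The map pulls e_{ij} back to q e_{ij} p. Degrees beyond index k are junk values from reduction
  -- modulo k + 1.
  refine ⟨conj q p hqp, fun n => g (Fin.ofNat (k + 1) n), fun i j hij => ?_⟩
  simp only [Fin.ofNat_eq_cast, Fin.cast_val_eq_self]
  rw [GroupGrading.mem_map_comp, conj_symm_apply]
  refine 𝒰.mem_comp_of_proj fun u hu => ?_
  -- In the homogeneous basis v this element is a matrix unit, so only its component of degree g_i⁻¹
  -- g_j can act nontrivially.
  have hx : ∀ l, v l * (q * unit F i j * p) = if l = i then v j else 0 := by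
    intro l
    rw [← hp l, mul_assoc q, ← mul_assoc, mul_assoc _ p q, hpq, mul_one, ← mul_assoc]
    split_ifs with hl
    · rw [hl, unit_mul_unit (Fin.zero_le _) hij, hp]
    · rw [unit_mul_unit_of_ne hl, zero_mul]
  have h0 : p * 𝒰.proj u (q * unit F i j * p) = 0 := by
    refine eq_zero_of_unit_mul fun l => ?_
    rw [← mul_assoc, hp, ← 𝒰.proj_mul_left _ (hv l), hx]
    split_ifs with hl
    · subst hl
      refine 𝒰.proj_of_mem_ne (hv j) fun h => hu ?_
      rw [h, inv_mul_cancel_left]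
    · rw [map_zero]
  rw [← one_mul (𝒰.proj u _), ← hqp, mul_assoc, h0, mul_zero]

namespace IsElementary

variable {𝒰 𝒱 : GroupGrading F (UT (k + 1) F) G} {h : ℕ → G}

/-- The diagonal units have degree 1, so cutting a down to e_{ii} a e_{jj} preserves its degree and
isolates one entry. -/
theorem mem_comp_iff (hU : IsElementary 𝒰 h) {g : G} {a : UT (k + 1) F} :
    a ∈ 𝒰.comp g ↔ ∀ i j, a.1 i j ≠ 0 → (h i)⁻¹ * h j = g := by
  constructor
  · intro ha i j hij
    have hle : i ≤ j := by
      by_contra h'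
      exact hij (apply_eq_zero a (not_le.1 h'))
    have h1 : unit F i i * a * unit F j j ∈ 𝒰.comp g := by
      have := 𝒰.mul_mem (𝒰.mul_mem (hU i i le_rfl) ha) (hU j j le_rfl)
      simpa using this
    rw [unit_mul_mul_unit hle] at h1
    exact 𝒰.eq_of_mem_of_mem ((𝒰.comp _).smul_mem _ (hU i j hle)) h1
      (smul_ne_zero hij (unit_ne_zero hle))
  · intro ha
    rw [eq_sum_unit a]
    refine Submodule.sum_mem _ fun i _ => Submodule.sum_mem _ fun j _ => ?_
    by_cases hij : a.1 i j = 0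
    · rw [hij, zero_smul]; exact Submodule.zero_mem _
    · have hle : i ≤ j := by
        by_contra h'
        exact hij (apply_eq_zero a (not_le.1 h'))
      rw [← ha i j hij]
      exact Submodule.smul_mem _ _ (hU i j hle)

theorem one_mem (hU : IsElementary 𝒰 h) : (1 : UT (k + 1) F) ∈ 𝒰.comp 1 := by
  rw [hU.mem_comp_iff]
  intro i j hij
  have : i = j := by
    by_contra hne
    exact hij (Matrix.one_apply_ne hne)
  rw [this, inv_mul_cancel]

/-- The inverse of an invertible element of trivial degree has trivial degree. -/
theorem inverse_mem (hU : IsElementary 𝒰 h) {a b : UT (k + 1) F} (ha : a ∈ 𝒰.comp 1)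
    (hab : a * b = 1) : b ∈ 𝒰.comp 1 := by
  refine 𝒰.mem_comp_of_proj fun u hu => ?_
  have h1 := 𝒰.proj_mul_left (g := u) b ha
  rw [hab, 𝒰.proj_of_mem_ne hU.one_mem (by simpa using hu.symm)] at h1
  rw [← one_mul (𝒰.proj u b), ← mul_eq_one_comm.1 hab, mul_assoc, ← h1, mul_zero]

open Polynomial in
theorem aeval_mem (hU : IsElementary 𝒰 h) {a : UT (k + 1) F} (ha : a ∈ 𝒰.comp 1) (f : F[X]) :
    aeval a f ∈ 𝒰.comp 1 := by
  have hpow : ∀ n : ℕ, a ^ n ∈ 𝒰.comp 1 := by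
    intro n
    induction n with
    | zero => simpa using hU.one_mem
    | succ n ih => simpa [pow_succ] using 𝒰.mul_mem ih ha
  rw [aeval_eq_sum_range]
  exact Submodule.sum_mem _ fun n _ => Submodule.smul_mem _ _ (hpow n)

/-- Elementary gradings with the same degrees of the elements `e_{l,l+1}` coincide. -/
theorem grading_eq {h' : ℕ → G} (hU : IsElementary 𝒰 h) (hV : IsElementary 𝒱 h')
    (hh : ∀ l < k, (h l)⁻¹ * h (l + 1) = (h' l)⁻¹ * h' (l + 1)) : 𝒰 = 𝒱 := by
  have h0 : ∀ l ≤ k, (h 0)⁻¹ * h l = (h' 0)⁻¹ * h' l := by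
    intro l
    induction l with
    | zero => simp
    | succ l ih =>
      intro hl
      have h1 := congrArg₂ (· * ·) (ih (by omega)) (hh l hl)
      simpa [mul_assoc] using h1
  have h2 : ∀ i j : Fin (k + 1), (h i)⁻¹ * h j = (h' i)⁻¹ * h' j := by
    intro i j
    have h1 := congrArg₂ (fun x y => x⁻¹ * y) (h0 i (by omega)) (h0 j (by omega))
    simpa [mul_assoc] using h1
  ext g a
  rw [hU.mem_comp_iff, hV.mem_comp_iff]
  simp only [h2]

end IsElementary

/-! ### The sign, and involutions with equal sign. -/

/-- A graded involution acts on the corner `e_{1m}` by a sign. -/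
theorem exists_sign {𝒰 : GroupGrading F (UT (k + 1) F) G} (s : GradedInvolution 𝒰) :
    ∃ η : F, (η = 1 ∨ η = -1) ∧ s.inv (unit F 0 (Fin.last k)) = η • unit F 0 (Fin.last k) := by
  set e := unit F 0 (Fin.last k) with he
  -- The corner line is annihilated by J on both sides; the involution swaps the two conditions, and
  -- together they pin down that line.
  have hrow : s.inv e ∈ firstRow k F := by
    rw [mem_firstRow_iff_mul]
    intro c hc
    have h1 : e * s.inv c = 0 := by
      apply ext_apply
      intro i j
      rw [he, unit_mul_apply]
      split_ifs with h
      · by_contra h'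
        exact absurd (lt_of_mem_strict (s.mem_strict hc) h') (not_lt.2 (Fin.le_last _))
      · rfl
    rw [← s.inv_inv c, ← s.inv_mul, h1, map_zero]
  have hcol : s.inv e ∈ colsFrom (k + 1) F k := by
    rw [mem_colsFrom_iff_mul (Nat.lt_succ_self k)]
    intro c hc
    have h1 : s.inv c * e = 0 := by
      apply ext_apply
      intro i j
      rw [he, mul_unit_apply]
      split_ifs with h
      · by_contra h'
        exact absurd (lt_of_mem_strict (s.mem_strict hc) h') (not_lt.2 (Fin.zero_le _))
      · rfl
    rw [← s.inv_inv c, ← s.inv_mul, h1, map_zero]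
    exact Submodule.zero_mem _
  have h1 : s.inv e = (s.inv e).1 0 (Fin.last k) • e := by
    apply ext_apply
    intro i j
    rw [smul_apply, he, unit_apply]
    by_cases hi : i = 0
    · by_cases hj : j = Fin.last k
      · rw [hi, hj, if_pos ⟨Fin.zero_le _, rfl, rfl⟩, mul_one]
      · rw [if_neg fun h => hj h.2.2, mul_zero]
        exact hcol i j (by grind)
    · rw [if_neg fun h => hi h.2.1, mul_zero]
      exact hrow i j hi
  refine ⟨_, ?_, h1⟩
  set η := (s.inv e).1 0 (Fin.last k)
  have h2 := s.inv_inv e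
  rw [h1, map_smul, h1, smul_smul] at h2
  have h3 : (η * η - 1) • e = 0 := by rw [sub_smul, h2, one_smul, sub_self]
  rcases smul_eq_zero.1 h3 with h4 | h4
  · exact mul_self_eq_one_iff.1 (sub_eq_zero.1 h4)
  · exact absurd h4 (unit_ne_zero (Fin.zero_le _))

/-- The centre consists of scalars. -/
theorem eq_smul_one_of_commute {z : UT (k + 1) F} (hz : ∀ b, b * z = z * b) :
    z = z.1 0 0 • 1 := by
  rw [← sub_eq_zero]
  refine eq_zero_of_unit_mul fun i => ?_
  rw [mul_sub, hz, mul_smul_comm, mul_one, sub_eq_zero]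
  apply ext_apply
  intro r l
  rw [mul_unit_apply, smul_apply, unit_apply]
  by_cases hr : r = 0
  · subst hr
    split_ifs <;> grind
  · rw [apply_eq_zero z (Fin.pos_of_ne_zero hr)]
    split_ifs <;> grind

/-- Two graded involutions of an elementary grading with the same sign are isomorphic. -/
theorem gStarIsomorphic_of_sign_eq [IsAlgClosed F] (h2 : (2 : F) ≠ 0)
    {𝒰 : GroupGrading F (UT (k + 1) F) G} {h : ℕ → G} (hU : IsElementary 𝒰 h)
    (s t : GradedInvolution 𝒰) {η : F} (hη : η ≠ 0)
    (hs : s.inv (unit F 0 (Fin.last k)) = η • unit F 0 (Fin.last k))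
    (ht : t.inv (unit F 0 (Fin.last k)) = η • unit F 0 (Fin.last k)) :
    GStarIsomorphic s t := by
  obtain ⟨p, q, hpq, hp, hφ⟩ := exists_conj (t.comp s)
  have hqp := mul_eq_one_comm.1 hpq
  have ht' : ∀ b, t.inv b = q * s.inv b * p := by
    intro b
    rw [← hφ, t.comp_apply, s.inv_inv]
  -- Row i of p is the first row of the image of e_{0i} under t ∘ s, which preserves degree.
  have hp1 : p ∈ 𝒰.comp 1 := by
    rw [hU.mem_comp_iff]
    intro i j hij
    have h1 := unit_mul_apply 0 i 0 j p
    rw [hp, if_pos ⟨Fin.zero_le i, rfl⟩, t.comp_apply] at h1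
    have h3 := hU.mem_comp_iff.1 (t.inv_mem (s.inv_mem (hU 0 i (Fin.zero_le i)))) 0 j
      (by rwa [h1])
    rw [mul_right_inj] at h3
    rw [h3, inv_mul_cancel]
  -- As t is an involution, q s(p) is central, so s(p) = cp. Equal signs make p commute with the
  -- corner e; applying s to pe, a multiple of e, then gives c = 1.
  have hsp : s.inv p = p := by
    have hz : ∀ b, b * (q * s.inv p) = q * s.inv p * b := by
      intro b
      have h3 := t.inv_inv b
      rw [ht', ht', s.inv_mul, s.inv_mul, s.inv_inv] at h3
      have h4 : s.inv q * p * (q * s.inv p) = 1 := by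
        rw [mul_assoc, ← mul_assoc p, hpq, one_mul, ← s.inv_mul, hpq, s.inv_one]
      calc b * (q * s.inv p) = q * (s.inv p * (b * s.inv q)) * p * (q * s.inv p) := by rw [h3]
        _ = q * s.inv p * b * (s.inv q * p * (q * s.inv p)) := by simp only [mul_assoc]
        _ = q * s.inv p * b := by rw [h4, mul_one]
    have h5 := eq_smul_one_of_commute hz
    set c := (q * s.inv p).1 0 0
    have h6 : s.inv p = c • p := by
      rw [← one_mul (s.inv p), ← hpq, mul_assoc, h5, mul_smul_comm, mul_one]
    set e := unit F 0 (Fin.last k) with he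
    have h7 : p * e = e * p := by
      have h8 := ht' e
      rw [ht, hs, mul_smul_comm, smul_mul_assoc] at h8
      have h9 : e = q * e * p := smul_right_injective _ hη h8
      conv_lhs => rw [h9]
      rw [← mul_assoc, ← mul_assoc, hpq, one_mul]
    have h8 : η • (p * e) = (c * η) • (p * e) := by
      have h10 : p * e = p.1 0 0 • e := by
        apply ext_apply
        intro r l
        rw [he, mul_unit_apply, smul_apply, unit_apply]
        by_cases hr : r = 0
        · subst hr; simp
        · rw [apply_eq_zero p (Fin.pos_of_ne_zero hr)]; simp [hr]
      have h9 : s.inv (p * e) = s.inv (p.1 0 0 • e) := by rw [h10]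
      rw [s.inv_mul, h6, hs, map_smul, hs, smul_comm _ η, ← h10, smul_mul_assoc,
        mul_smul_comm, ← h7, smul_smul, mul_comm] at h9
      rw [← h9, mul_comm]
    have h11 : p * e ≠ 0 := by
      intro h12
      apply unit_ne_zero (F := F) (Fin.zero_le (Fin.last k))
      rw [← he, ← one_mul e, ← hqp, mul_assoc, h12, mul_zero]
    have h12 : η = c * η := smul_left_injective F h11 h8
    rw [h6, (mul_eq_right₀ hη).1 h12.symm, one_smul]
  -- A polynomial in p inherits both symmetry under s and degree 1.
  obtain ⟨f, hf⟩ := IsUnit.exists_aeval_sq_eq h2 (IsUnit.of_mul_eq_one q hpq)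
    (Algebra.IsIntegral.isIntegral p)
  set w := Polynomial.aeval p f with hw
  have hsw : s.inv w = w := by rw [hw, s.inv_aeval, hsp]
  have hwx : w * (w * q) = 1 := by rw [← mul_assoc, ← sq, hf, hpq]
  set x := w * q with hx
  have hxw := mul_eq_one_comm.1 hwx
  have hw1 : w ∈ 𝒰.comp 1 := hU.aeval_mem hp1 f
  have hx1 : x ∈ 𝒰.comp 1 := hU.inverse_mem hw1 hwx
  have hsx : s.inv x = x := by
    have h3 : s.inv x * w = 1 := by rw [← hsw, ← s.inv_mul, hwx, s.inv_one]
    rw [← mul_one (s.inv x), ← hwx, ← mul_assoc, h3, one_mul]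
  have hq : q = x * x := by
    rw [hx, ← mul_assoc, ← hx, hxw, one_mul]
  refine ⟨conj w x hwx, fun g a ha => ?_, fun a => ?_⟩
  · rw [conj_apply]
    simpa using 𝒰.mul_mem hx1 (𝒰.mul_mem ha hw1)
  · rw [ht', conj_apply, conj_apply, s.inv_mul, s.inv_mul, hsx, hsw, hq, ← hf, sq]
    simp only [mul_assoc]
    rw [← mul_assoc x w, hxw, one_mul, ← mul_assoc x w, hxw, one_mul]

end UT

/-! ### Identities detecting size, degrees and sign. -/

/-- The product of the commutators `[x_{2l,1}, x_{2l+1,γ(l)}]` for `l < k`. -/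
noncomputable def GStarFree.commProd (F : Type*) {G : Type*} [Field F] [Group G] (γ : ℕ → G) :
    ℕ → GStarFree F G
  | 0 => 1
  | k + 1 => commProd F γ k *
      (FreeAlgebra.ι F (GStarVar.x (2 * k) 1) * FreeAlgebra.ι F (GStarVar.x (2 * k + 1) (γ k)) -
        FreeAlgebra.ι F (GStarVar.x (2 * k + 1) (γ k)) * FreeAlgebra.ι F (GStarVar.x (2 * k) 1))

namespace UT

open GStarFree

variable {F : Type*} [Field F] {k : ℕ} {G : Type*} [Group G]
  {𝒰 : GroupGrading F (UT (k + 1) F) G} {h : ℕ → G}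

/-- Nonzero entries of values of products of commutators. -/
theorem eval_commProd_apply_ne_zero (hU : IsElementary 𝒰 h) (s : GradedInvolution 𝒰)
    (γ : ℕ → G) {a : ℕ → G → UT (k + 1) F} (ha : ∀ i g, a i g ∈ 𝒰.comp g) (n : ℕ)
    (i j : Fin (k + 1)) (hij : (s.eval a (commProd F γ n)).1 i j ≠ 0) :
    (i : ℕ) + n ≤ j ∧ ((i : ℕ) + n = j → ∀ l < n, (h (i + l))⁻¹ * h (i + l + 1) = γ l) := by
  induction n generalizing j with
  | zero =>
    rw [commProd, map_one] at hij
    have : i = j := by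
      by_contra hne
      exact hij (Matrix.one_apply_ne hne)
    simp [this]
  | succ n ih =>
    rw [commProd, map_mul, mul_apply] at hij
    obtain ⟨r, -, hr⟩ := Finset.exists_ne_zero_of_sum_ne_zero hij
    obtain ⟨h1, h2⟩ := ih r (left_ne_zero_of_mul hr)
    have h3 := right_ne_zero_of_mul hr
    simp only [map_sub, map_mul, s.eval_x] at h3
    -- Each commutator moves at least one column to the right; with no slack, every step is on the
    -- superdiagonal and its degree must be γ(l).
    have hlt := lt_of_mem_strict (commutator_mem_strict _ _) h3
    refine ⟨by omega, fun heq l hl => ?_⟩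
    have hrn : (i : ℕ) + n = r := by omega
    rcases Nat.lt_succ_iff_lt_or_eq.1 hl with h4 | h4
    · exact h2 hrn l h4
    · have h5 := s.commutator_mem (ha (2 * n) 1) (ha (2 * n + 1) (γ n))
      rw [one_mul] at h5
      have h6 := hU.mem_comp_iff.1 h5 r j h3
      rw [h4, hrn, ← h6]
      congr 2
      omega

theorem commProd_mem_identities_of_lt (hU : IsElementary 𝒰 h) (s : GradedInvolution 𝒰)
    (γ : ℕ → G) {n : ℕ} (hn : k < n) : commProd F γ n ∈ s.identities := by
  intro a ha
  by_contra hne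
  obtain ⟨i, j, hij⟩ := exists_apply_ne_zero hne
  have := (eval_commProd_apply_ne_zero hU s γ ha n i j hij).1
  omega

/-- Among k + 1 indices, k increasing steps must visit every index in turn. -/
theorem degree_eq_of_commProd_notMem (hU : IsElementary 𝒰 h) (s : GradedInvolution 𝒰)
    {γ : ℕ → G} (hn : commProd F γ k ∉ s.identities) :
    ∀ l < k, (h l)⁻¹ * h (l + 1) = γ l := by
  by_contra hcon
  refine hn fun a ha => ?_
  by_contra hne
  obtain ⟨i, j, hij⟩ := exists_apply_ne_zero hne
  have h1 := eval_commProd_apply_ne_zero hU s γ ha k i j hij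
  have hi : (i : ℕ) = 0 := by omega
  refine hcon fun l hl => ?_
  simpa [hi] using h1.2 (by omega) l hl

/-- The values of a product of `k` commutators are multiples of the corner of `UT (k + 1)`. -/
theorem eval_commProd_eq_smul (hU : IsElementary 𝒰 h) (s : GradedInvolution 𝒰)
    (γ : ℕ → G) {a : ℕ → G → UT (k + 1) F} (ha : ∀ i g, a i g ∈ 𝒰.comp g) :
    ∃ c : F, s.eval a (commProd F γ k) = c • unit F 0 (Fin.last k) := by
  refine ⟨(s.eval a (commProd F γ k)).1 0 (Fin.last k), ?_⟩
  apply ext_apply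
  intro i j
  rw [smul_apply, unit_apply]
  by_cases hij : i = 0 ∧ j = Fin.last k
  · rw [hij.1, hij.2, if_pos ⟨Fin.zero_le _, rfl, rfl⟩, mul_one]
  · rw [if_neg fun h => hij h.2, mul_zero]
    by_contra hne
    have h1 := (eval_commProd_apply_ne_zero hU s γ ha k i j hne).1
    exact hij ⟨Fin.ext (by rw [Fin.val_zero]; omega), Fin.ext (by rw [Fin.val_last]; omega)⟩

/-- Some value of the product of commutators with the degrees of the grading is the corner. -/
theorem exists_eval_commProd_eq_unit (hU : IsElementary 𝒰 h) (s : GradedInvolution 𝒰) :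
    ∃ a : ℕ → G → UT (k + 1) F, (∀ i g, a i g ∈ 𝒰.comp g) ∧
      s.eval a (commProd F (fun l => (h l)⁻¹ * h (l + 1)) k) = unit F 0 (Fin.last k) := by
  classical
  -- For l < k, u(2l) = e_{ll} and u(2l+1) = e_{l,l+1}, whose commutator is e_{l,l+1}. Below, 0 is
  -- substituted wherever the degree does not match.
  let u : ℕ → UT (k + 1) F := fun i =>
    unit F (Fin.ofNat (k + 1) (i / 2)) (Fin.ofNat (k + 1) ((i + 1) / 2))
  let a : ℕ → G → UT (k + 1) F := fun i g => if u i ∈ 𝒰.comp g then u i else 0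
  have ha : ∀ i g, a i g ∈ 𝒰.comp g := by
    intro i g
    simp only [a]
    split_ifs with hi
    · exact hi
    · exact Submodule.zero_mem _
  refine ⟨a, ha, ?_⟩
  -- The factor e_{00} makes the empty product start at the matrix unit e_{00}, so that the units
  -- telescope.
  have key : ∀ n (hn : n < k + 1),
      unit F 0 0 * s.eval a (commProd F (fun l => (h l)⁻¹ * h (l + 1)) n) =
        unit F 0 ⟨n, hn⟩ := by
    intro n
    induction n with
    | zero =>
      intro hn
      rw [commProd, map_one, mul_one]
      rfl
    | succ n ih =>
      intro hn
      have hn' : n < k + 1 := by omega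
      have hu0 : u (2 * n) = unit F ⟨n, hn'⟩ ⟨n, hn'⟩ := by
        have h1 : 2 * n / 2 = n := by omega
        have h2 : (2 * n + 1) / 2 = n := by omega
        simp only [u, h1, h2]
        congr <;> exact Fin.ext (Nat.mod_eq_of_lt hn')
      have hu1 : u (2 * n + 1) = unit F ⟨n, hn'⟩ ⟨n + 1, hn⟩ := by
        have h1 : (2 * n + 1) / 2 = n := by omega
        have h2 : (2 * n + 1 + 1) / 2 = n + 1 := by omega
        simp only [u, h1, h2]
        congr
        · exact Fin.ext (Nat.mod_eq_of_lt hn')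
        · exact Fin.ext (Nat.mod_eq_of_lt hn)
      have ha0 : a (2 * n) 1 = unit F ⟨n, hn'⟩ ⟨n, hn'⟩ := by
        have := hU ⟨n, hn'⟩ ⟨n, hn'⟩ le_rfl
        rw [inv_mul_cancel] at this
        simp only [a]
        rw [hu0, if_pos this]
      have ha1 : a (2 * n + 1) ((h n)⁻¹ * h (n + 1)) = unit F ⟨n, hn'⟩ ⟨n + 1, hn⟩ := by
        simp only [a]
        rw [hu1, if_pos (hU ⟨n, hn'⟩ ⟨n + 1, hn⟩ (by simp))]
      have hlt : (⟨n, hn'⟩ : Fin (k + 1)) < ⟨n + 1, hn⟩ := by simp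
      rw [commProd, map_mul, ← mul_assoc, ih hn']
      simp only [map_sub, map_mul, s.eval_x, ha0, ha1]
      rw [← unit_eq_commutator hlt, unit_mul_unit (Fin.zero_le _) hlt.le]
  obtain ⟨c, hc⟩ := eval_commProd_eq_smul hU s (fun l => (h l)⁻¹ * h (l + 1)) ha
  have h1 := key k (Nat.lt_succ_self k)
  rw [hc, mul_smul_comm, unit_mul_unit le_rfl (Fin.zero_le _)] at h1
  exact hc.trans h1

theorem commProd_notMem_identities (hU : IsElementary 𝒰 h) (s : GradedInvolution 𝒰) :
    commProd F (fun l => (h l)⁻¹ * h (l + 1)) k ∉ s.identities := by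
  intro hmem
  obtain ⟨a, ha, hval⟩ := exists_eval_commProd_eq_unit hU s
  exact unit_ne_zero (Fin.zero_le _) (hval.symm.trans (hmem a ha))

/-- The sign of a graded involution is determined by its identities. -/
theorem commProd_star_sub_mem_identities_iff (hU : IsElementary 𝒰 h) (s : GradedInvolution 𝒰)
    {η : F} (hs : s.inv (unit F 0 (Fin.last k)) = η • unit F 0 (Fin.last k)) (μ : F) :
    (star F G (commProd F (fun l => (h l)⁻¹ * h (l + 1)) k)).unop -
      μ • commProd F (fun l => (h l)⁻¹ * h (l + 1)) k ∈ s.identities ↔ η = μ := by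
  constructor
  · intro hmem
    obtain ⟨a, ha, hval⟩ := exists_eval_commProd_eq_unit hU s
    have h1 := hmem a ha
    rw [map_sub, s.eval_star, map_smul, hval, hs, sub_eq_zero] at h1
    exact smul_left_injective F (unit_ne_zero (Fin.zero_le _)) h1
  · rintro rfl a ha
    obtain ⟨c, hc⟩ := eval_commProd_eq_smul hU s (fun l => (h l)⁻¹ * h (l + 1)) ha
    rw [map_sub, s.eval_star, map_smul, hc, map_smul, hs, smul_comm, sub_self]

end UT

theorem mainTheorem9 {F : Type*} [Field F] [IsAlgClosed F] (hF : ringChar F ≠ 2)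
    {G : Type*} [Group G] {m n : ℕ} (hm : 0 < m) (hn : 0 < n)
    (𝒰 : GroupGrading F (UT m F) G) (s : GradedInvolution 𝒰)
    (𝒱 : GroupGrading F (UT n F) G) (t : GradedInvolution 𝒱) :
    GStarIsomorphic s t ↔ s.identities = t.identities := by
  refine ⟨GStarIsomorphic.identities_eq, fun hst => ?_⟩
  obtain ⟨k, rfl⟩ := Nat.exists_eq_add_one.2 hm
  obtain ⟨l, rfl⟩ := Nat.exists_eq_add_one.2 hn
  obtain ⟨φ, h, hU⟩ := UT.exists_isElementary_map s
  obtain ⟨ψ, h', hV⟩ := UT.exists_isElementary_map t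
  have hs := s.gStarIsomorphic_map φ
  have ht := t.gStarIsomorphic_map ψ
  rw [hs.identities_eq, ht.identities_eq] at hst
  refine hs.trans (GStarIsomorphic.trans ?_ ht.symm)
  clear hs ht hm hn
  -- The transported gradings become variables, so that their equality can be substituted.
  generalize s.map φ = s' at *
  generalize t.map ψ = t' at *
  generalize 𝒰.map φ = 𝒰' at *
  generalize 𝒱.map ψ = 𝒱' at *
  have hs := UT.commProd_notMem_identities hU s'
  have ht := UT.commProd_notMem_identities hV t'
  -- The nonvanishing product for the larger algebra would be an identity of the smaller one.
  have hkl : k = l := by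
    rcases lt_trichotomy k l with hlt | heq | hlt
    · exact absurd (UT.commProd_mem_identities_of_lt hU s' _ hlt) (hst ▸ ht)
    · exact heq
    · exact absurd (UT.commProd_mem_identities_of_lt hV t' _ hlt) (hst ▸ hs)
  subst hkl
  rw [hst] at hs
  obtain rfl := hU.grading_eq hV fun l hl => (UT.degree_eq_of_commProd_notMem hV t' hs l hl).symm
  obtain ⟨η, hη, hsη⟩ := UT.exists_sign s'
  obtain ⟨μ, -, htμ⟩ := UT.exists_sign t'
  -- The identity f* - ηf of the first involution, read in the second, forces equal signs.
  have h1 := (UT.commProd_star_sub_mem_identities_iff hU s' hsη η).2 rfl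
  rw [hst, UT.commProd_star_sub_mem_identities_iff hU t' htμ] at h1
  subst h1
  refine UT.gStarIsomorphic_of_sign_eq (Ring.two_ne_zero hF) hU s' t' ?_ hsη htμ
  rcases hη with rfl | rfl
  · exact one_ne_zero
  · exact neg_ne_zero.2 one_ne_zero
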